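/- For a group $G$ and a subgroup $H\le G$ write $Z(G)$ for the centre of $G$, $N_G(H)$ and $C_G(H)$ for the normalizer and the centralizer of $H$ in $G$, and $[G:H]$ for the index (a cardinal). A group $G$ is finite-by-abelian if its commutator subgroup $G'$ is finite. (C) For every finite-by-abelian group $G$ the following are equivalent: (i) $|G/Z(G)|<\omega_1$; (ii) $[G:N_G(U)]<\omega_1$ for all subgroups $U\le G$; (iii) $[G:N_G(A)]<\omega_1$ for all abelian subgroups $A\le G$. (C') Let $\mathcal Z$ (respectively $\mathcal Y$) be the class of locally finite groups $G$ such that for all infinite cardinals $\kappa$ and all subgroups $H\le G$ with $|H|<\kappa$ one has $[G:C_G(H)]<\kappa$ (respectively $[G:N_G(H)]<\kappa$). Then a finite-by-abelian group of cardinality $\omega_1$ belongs to $\mathcal Y$ if and only if it belongs to $\mathcal Z$. -/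

import Mathlib

open Cardinal

universe u

/-- A group is finite-by-abelian if its commutator subgroup `G'` is finite. -/
def IsFiniteByAbelian (G : Type u) [Group G] : Prop :=
  Finite (commutator G)

/-- A group is locally finite if all its finitely generated subgroups are finite. -/
def IsLocallyFiniteGroup (G : Type u) [Group G] : Prop :=
  ∀ H : Subgroup G, H.FG → Finite H

/-- The index `[G : H]` as a cardinal number. -/
def cardIndex {G : Type u} [Group G] (H : Subgroup G) : Cardinal.{u} :=
  #(G ⧸ H)

/-- The class `𝒵`: locally finite groups `G` such that for every infinite cardinal `κ` and every
subgroup `H` of size less than `κ`, the centralizer of `H` has index less than `κ`. -/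
def IsTomkinsonZ (G : Type u) [Group G] : Prop :=
  IsLocallyFiniteGroup G ∧
    ∀ κ : Cardinal.{u}, ℵ₀ ≤ κ → ∀ H : Subgroup G, #H < κ →
      cardIndex (Subgroup.centralizer (H : Set G)) < κ

/-- The class `𝒴`: locally finite groups `G` such that for every infinite cardinal `κ` and every
subgroup `H` of size less than `κ`, the normalizer of `H` has index less than `κ`. -/
def IsTomkinsonY (G : Type u) [Group G] : Prop :=
  IsLocallyFiniteGroup G ∧
    ∀ κ : Cardinal.{u}, ℵ₀ ≤ κ → ∀ H : Subgroup G, #H < κ →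
      cardIndex (Subgroup.normalizer (H : Set G)) < κ

/-!
The content of the theorem is one implication: if `G'` is finite and `N(A)` has countable index for
every abelian subgroup `A` of `H`, then `C(H)` has countable index
(`countable_quotient_centralizer_of_forall_normalizer`).

Elements of `G` have finitely many conjugates, so `H` may be replaced by a subgroup of finite index,
and one may assume that `H` commutes with `G'`. Then commutators are bimultiplicative on `H`.

*Normalizers and centralizers.* If a subgroup `B` avoids `G'`, then `N(B) = C(B)`. An abelian
subgroup `A` commuting with `G'` has its `|G'|`-th powers in the centre, so it is enough to find a
subgroup `B` of `A` that avoids `G'` and has finite index in `A` modulo those powers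
(`CommGroup.exists_disjoint_sup_range_pow_finiteIndex`). A subgroup `B` maximal among those avoiding
`G'` works: `A ⧸ B` is a torsion group with finitely many elements of each order, hence finite
modulo its `|G'|`-th powers.

*Abelian and arbitrary subgroups.* By induction on the order of `⁅H, H⁆`, suppose that `H` is not
abelian and compose the commutator with a nontrivial homomorphism `χ : ⁅H, H⁆ → ZMod p`, which gives
an alternating pairing on `H`. Let `M` be a maximal isotropic subgroup. Since `⁅M, M⁆ ≤ ker χ`, the
inductive hypothesis shows that `C(M)` has countable index in `G`, and `H ⊓ C(M) ≤ M` because `M` is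
its own orthogonal, so `M` has countable index in `H`. A maximal isotropic subspace of countable
codimension has an isotropic complement (`LinearMap.BilinForm.exists_isotropic_sup_eq_top`), built
one vector at a time. So `H` is generated by `M` and an isotropic subgroup `N`; the inductive
hypothesis applies to `N` as well, and `C(H) = C(M) ⊓ C(N)`.
-/

/-! ### Isotropic complements of maximal isotropic subspaces -/

/-- Extension step for an isotropic complement: a finite-dimensional isotropic subspace `S`
meeting `M` trivially can be enlarged so that `S ⊔ M` captures a given vector `b`. When `b` is not
captured yet, a translate `b + a` with `a ∈ M` is orthogonal to `S`, and it is adjoined to `S`. -/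
theorem LinearMap.BilinForm.exists_isotropic_extension {K V : Type*} [Field K] [AddCommGroup V]
    [Module K V] (B : LinearMap.BilinForm K V) (hB : B.IsAlt) (M : Submodule K V)
    (hM : ∀ v, (∀ m ∈ M, B m v = 0) → v ∈ M) (S : Submodule K V) [FiniteDimensional K S]
    (hS : ∀ x ∈ S, ∀ y ∈ S, B x y = 0) (hSM : S ⊓ M = ⊥) (b : V) :
    ∃ S' : Submodule K V, FiniteDimensional K S' ∧ (∀ x ∈ S', ∀ y ∈ S', B x y = 0) ∧
      S' ⊓ M = ⊥ ∧ S ≤ S' ∧ b ∈ S' ⊔ M := by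
  by_cases hb : b ∈ S ⊔ M
  · exact ⟨S, ‹_›, hS, hSM, le_rfl, hb⟩
  -- Since `S ⊓ M^⊥ ≤ S ⊓ M = ⊥`, every functional on `S` is represented by a vector of `M`.
  let T : M →ₗ[K] S →ₗ[K] K := B.domRestrict₁₂ M S
  have hT : Function.Surjective T := by
    rw [← LinearMap.flip_injective_iff₂, injective_iff_map_eq_zero]
    intro s hs
    have h1 : (s : V) ∈ M := hM _ fun m hm => by
      exact LinearMap.congr_fun hs ⟨m, hm⟩
    have h2 : (s : V) ∈ S ⊓ M := ⟨s.2, h1⟩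
    rw [hSM] at h2
    exact Subtype.ext (by simpa using h2)
  obtain ⟨a, ha⟩ := hT (-(B b ∘ₗ S.subtype))
  set c : V := b + a with hc
  have hcS : ∀ s ∈ S, B c s = 0 := fun s hs => by
    have : B a s = -B b s := LinearMap.congr_fun ha ⟨s, hs⟩
    simp [hc, this]
  have hSc : ∀ s ∈ S, B s c = 0 := fun s hs => by
    rw [← hB.neg_eq, hcS s hs, neg_zero]
  refine ⟨S ⊔ K ∙ c, inferInstance, ?_, ?_, le_sup_left, ?_⟩
  · intro x hx y hy
    obtain ⟨s, hs, _, hk, rfl⟩ := Submodule.mem_sup.1 hx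
    obtain ⟨s', hs', _, hk', rfl⟩ := Submodule.mem_sup.1 hy
    obtain ⟨k, rfl⟩ := Submodule.mem_span_singleton.1 hk
    obtain ⟨k', rfl⟩ := Submodule.mem_span_singleton.1 hk'
    simp [hS s hs s' hs', hcS s' hs', hSc s hs, hB.self_eq_zero]
  · rw [eq_bot_iff]
    rintro x ⟨hx, hxM⟩
    obtain ⟨s, hs, _, hk, rfl⟩ := Submodule.mem_sup.1 hx
    obtain ⟨k, rfl⟩ := Submodule.mem_span_singleton.1 hk
    rcases eq_or_ne k 0 with rfl | hk0
    · rw [← hSM]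
      simpa using And.intro hs (by simpa using hxM)
    · refine absurd ?_ hb
      have h3 : k • b = -s + ((s + k • c) - k • (a : V)) := by rw [hc, smul_add]; abel
      have h4 : k • b ∈ S ⊔ M := by
        rw [h3]
        exact Submodule.add_mem_sup (S.neg_mem hs) (M.sub_mem hxM (M.smul_mem _ a.2))
      simpa [smul_smul, inv_mul_cancel₀ hk0] using (S ⊔ M).smul_mem k⁻¹ h4
  · have : b = c + -(a : V) := by rw [hc]; abel
    rw [this]
    exact Submodule.add_mem_sup (Submodule.mem_sup_right (Submodule.mem_span_singleton_self c))
      (M.neg_mem a.2)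

/-- If `M` contains its orthogonal and has a countable quotient, it has an isotropic complement.
Countability is essential: the complement is the union of a chain of finite-dimensional stages, and
a vector of `M` realising prescribed values is only available against finitely many vectors. -/
theorem LinearMap.BilinForm.exists_isotropic_sup_eq_top {K V : Type*} [Field K] [AddCommGroup V]
    [Module K V] (B : LinearMap.BilinForm K V) (hB : B.IsAlt) (M : Submodule K V)
    (hM : ∀ v, (∀ m ∈ M, B m v = 0) → v ∈ M) [Countable (V ⧸ M)] :
    ∃ N : Submodule K V, (∀ x ∈ N, ∀ y ∈ N, B x y = 0) ∧ M ⊔ N = ⊤ := by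
  obtain ⟨q, hq⟩ := exists_surjective_nat (V ⧸ M)
  choose b hb using fun n => M.mkQ_surjective (q n)
  let State := {S : Submodule K V //
    FiniteDimensional K S ∧ (∀ x ∈ S, ∀ y ∈ S, B x y = 0) ∧ S ⊓ M = ⊥}
  have step : ∀ (S : State) (v : V), ∃ S' : State, S.1 ≤ S'.1 ∧ v ∈ S'.1 ⊔ M := by
    rintro ⟨S, h1, h2, h3⟩ v
    obtain ⟨S', h1', h2', h3', h4, h5⟩ := B.exists_isotropic_extension hB M hM S h2 h3 v
    exact ⟨⟨S', h1', h2', h3'⟩, h4, h5⟩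
  choose next hle hmem using step
  let S : ℕ → State := fun n =>
    Nat.rec ⟨⊥, inferInstance, by simp, by simp⟩ (fun k T => next T (b k)) n
  have hmono : Monotone fun n => (S n).1 := monotone_nat_of_le_succ fun n => hle (S n) (b n)
  refine ⟨⨆ n, (S n).1, ?_, ?_⟩
  · intro x hx y hy
    obtain ⟨i, hi⟩ := (Submodule.mem_iSup_of_directed _ hmono.directed_le).1 hx
    obtain ⟨j, hj⟩ := (Submodule.mem_iSup_of_directed _ hmono.directed_le).1 hy
    exact (S (max i j)).2.2.1 x (hmono (le_max_left i j) hi) y (hmono (le_max_right i j) hj)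
  · rw [eq_top_iff]
    rintro v -
    obtain ⟨n, hn⟩ := hq (M.mkQ v)
    have h1 : v - b n ∈ M := by
      rw [← Submodule.Quotient.mk_eq_zero, Submodule.Quotient.mk_sub]
      exact sub_eq_zero.2 (hn.symm.trans (hb n).symm)
    have h2 : b n ∈ (S (n + 1)).1 ⊔ M := hmem (S n) (b n)
    have h3 : (S (n + 1)).1 ⊔ M ≤ M ⊔ ⨆ n, (S n).1 := by
      rw [sup_comm]
      exact sup_le_sup_left (le_iSup (fun n => (S n).1) (n + 1)) M
    simpa using add_mem (h3 h2) (Submodule.mem_sup_left h1)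

/-! ### Avoiding a finite subgroup of an abelian group -/

/-- A subgroup `A₀` maximal among those disjoint from `F`. Maximality says that every nontrivial
element of `A ⧸ A₀` has a power equal to a nontrivial element of the image of `F`. -/
theorem CommGroup.exists_maximal_disjoint {A : Type*} [CommGroup A] (F : Subgroup A) :
    ∃ A₀ : Subgroup A, Disjoint A₀ F ∧ ∀ x ∉ A₀, ∃ f ∈ F, f ∉ A₀ ∧
      ∃ k : ℤ, (x : A ⧸ A₀) ^ k = f := by
  obtain ⟨A₀, -, hA₀⟩ := zorn_le_nonempty₀ {B : Subgroup A | Disjoint B F} (by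
    intro c hc hchain B hB
    refine ⟨sSup c, Subgroup.disjoint_def.2 fun {x} hx hxF => ?_, fun _ => le_sSup⟩
    obtain ⟨B', hB', hxB'⟩ := (Subgroup.mem_sSup_of_directedOn ⟨B, hB⟩ hchain.directedOn).1 hx
    exact Subgroup.disjoint_def.1 (hc hB') hxB' hxF) ⊥ disjoint_bot_left
  refine ⟨A₀, hA₀.prop, fun x hx => ?_⟩
  have h1 : ¬ Disjoint (A₀ ⊔ Subgroup.zpowers x) F := fun h =>
    hx (hA₀.le_of_ge h le_sup_left (Subgroup.mem_sup_right (Subgroup.mem_zpowers x)))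
  rw [Subgroup.disjoint_def] at h1
  push Not at h1
  obtain ⟨f, hf, hfF, hf1⟩ := h1
  obtain ⟨a, ha, _, ⟨k, rfl⟩, rfl⟩ := Subgroup.mem_sup.1 hf
  refine ⟨_, hfF, fun h => hf1 (Subgroup.disjoint_def.1 hA₀.prop h hfF), k, ?_⟩
  simp [(QuotientGroup.eq_one_iff a).2 ha]

theorem CommGroup.finite_setOf_pow_eq_one_of_prime {D : Type*} [CommGroup D]
    (h : ∀ p : ℕ, p.Prime → {x : D | x ^ p = 1}.Finite) {n : ℕ} (hn : n ≠ 0) :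
    {x : D | x ^ n = 1}.Finite := by
  induction n using Nat.recOnMul with
  | zero => exact absurd rfl hn
  | one => simp
  | prime p hp => exact h p hp
  | mul a b iha ihb =>
    have ha := iha (left_ne_zero_of_mul hn)
    have hb := ihb (right_ne_zero_of_mul hn)
    have h1 : {x : D | x ^ (a * b) = 1} ⊆ (fun x => x ^ a) ⁻¹' {x : D | x ^ b = 1} := by
      intro x hx
      simpa [pow_mul] using hx
    refine (hb.preimage' fun y _ => ?_).subset h1
    rcases ((fun x : D => x ^ a) ⁻¹' {y}).eq_empty_or_nonempty with he | ⟨z, hz⟩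
    · simp [he]
    · refine (ha.image (z * ·)).subset fun x hx => ⟨z⁻¹ * x, ?_, by simp⟩
      have hz' : z ^ a = y := hz
      have hx' : x ^ a = y := hx
      simp [mul_pow, hz', hx']

/-- For a finite abelian group `W` the `e`-torsion and `W ⧸ W ^ e` have the same order. Applied to
the finite subgroups of a torsion group `D`, this bounds `D ⧸ D ^ e` by the `e`-torsion of `D`. -/
theorem CommGroup.finite_quotient_range_pow {D : Type*} [CommGroup D]
    (hD : IsMulTorsion D) (e : ℕ) (he : {x : D | x ^ e = 1}.Finite) :
    Finite (D ⧸ (powMonoidHom e : D →* D).range) := by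
  by_contra hinf
  rw [not_finite_iff_infinite] at hinf
  obtain ⟨s, hs⟩ := Infinite.exists_subset_card_eq (D ⧸ (powMonoidHom e : D →* D).range)
    (he.toFinset.card + 1)
  classical
  -- The subgroup generated by lifts of the elements of `s` is finite.
  let W : Subgroup D := Subgroup.closure ((s.image Quotient.out : Finset D) : Set D)
  have hWfg : Group.FG W := (Group.fg_iff_subgroup_fg W).2 ⟨_, rfl⟩
  have hWfin : Finite W := CommGroup.finite_of_fg_isMulTorsion W (hD.subgroup W)
  let φ : W →* W := powMonoidHom e
  have hker : Nat.card φ.ker ≤ he.toFinset.card := by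
    rw [← Set.ncard_eq_toFinset_card _ he, ← Nat.card_coe_set_eq]
    have : Finite {x : D | x ^ e = 1} := he
    refine Nat.card_le_card_of_injective
      (fun w : φ.ker => (⟨w.1.1, congrArg Subtype.val w.2⟩ : {x : D | x ^ e = 1})) ?_
    intro v w hvw
    exact Subtype.ext (Subtype.ext (Subtype.mk.inj hvw))
  have hidx : φ.range.index = Nat.card φ.ker := by
    exact Subgroup.index_range
  let ψ : W ⧸ φ.range →* D ⧸ (powMonoidHom e : D →* D).range :=
    QuotientGroup.map _ _ W.subtype (by
      rintro _ ⟨w, rfl⟩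
      exact ⟨w, rfl⟩)
  have hsub : (s : Set _) ⊆ Set.range ψ := by
    intro x hx
    refine ⟨((⟨x.out, Subgroup.subset_closure
      (Finset.mem_coe.2 (Finset.mem_image_of_mem _ hx))⟩ : W) : W ⧸ φ.range), ?_⟩
    exact Quotient.out_eq x
  have h1 : s.card ≤ Nat.card (W ⧸ φ.range) := by
    rw [← Set.ncard_coe_finset]
    refine (Set.ncard_le_ncard hsub (Set.finite_range ψ)).trans ?_
    exact Finite.card_range_le ψ
  have h2 : Nat.card (W ⧸ φ.range) = φ.range.index := rfl
  omega

/-- A finite subgroup `F` of an abelian group `A` is avoided by a subgroup `A₀` that has finite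
index in `A` up to `e`-th powers. For `A₀` maximal disjoint from `F`, the quotient `A ⧸ A₀` is
torsion and its elements of prime order lie in the image of `F`. -/
theorem CommGroup.exists_disjoint_sup_range_pow_finiteIndex {A : Type*} [CommGroup A]
    (F : Subgroup A) [Finite F] {e : ℕ} (he : e ≠ 0) :
    ∃ A₀ : Subgroup A, Disjoint A₀ F ∧ (A₀ ⊔ (powMonoidHom e : A →* A).range).FiniteIndex := by
  obtain ⟨A₀, hdis, hmax⟩ := CommGroup.exists_maximal_disjoint F
  refine ⟨A₀, hdis, ?_⟩
  have key : ∀ x : A ⧸ A₀, x = 1 ∨ ∃ f ∈ F, (f : A ⧸ A₀) ≠ 1 ∧ ∃ k : ℤ, x ^ k = f := by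
    intro x
    induction x using QuotientGroup.induction_on with | H x =>
    by_cases hx : x ∈ A₀
    · exact .inl ((QuotientGroup.eq_one_iff x).2 hx)
    · obtain ⟨f, hf, hfA, k, hk⟩ := hmax x hx
      exact .inr ⟨f, hf, fun h => hfA ((QuotientGroup.eq_one_iff f).1 h), k, hk⟩
  have htors : IsMulTorsion (A ⧸ A₀) := by
    intro x
    obtain rfl | ⟨f, hf, hf1, k, hk⟩ := key x
    · exact IsOfFinOrder.one
    · have h1 : IsOfFinOrder (x ^ k) := by
        rw [hk]
        exact (QuotientGroup.mk' A₀).isOfFinOrder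
          (F.subtype.isOfFinOrder (isOfFinOrder_of_finite (⟨f, hf⟩ : F)))
      have hk0 : k ≠ 0 := by
        rintro rfl
        exact hf1 (by rw [← hk, zpow_zero])
      obtain ⟨n, hn, h2⟩ := isOfFinOrder_iff_zpow_eq_one.1 h1
      exact isOfFinOrder_iff_zpow_eq_one.2 ⟨k * n, mul_ne_zero hk0 hn, by rwa [zpow_mul]⟩
  have hprime : ∀ p : ℕ, p.Prime → {x : A ⧸ A₀ | x ^ p = 1}.Finite := by
    intro p hp
    refine (Set.toFinite ((fun f : A => (f : A ⧸ A₀)) '' F)).subset fun x hx => ?_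
    have hx' : x ^ p = 1 := hx
    obtain rfl | ⟨f, hf, hf1, k, hk⟩ := key x
    · exact ⟨1, F.one_mem, rfl⟩
    · have hpk : ¬ (p : ℤ) ∣ k := by
        rintro ⟨j, rfl⟩
        apply hf1
        rw [← hk, zpow_mul, zpow_natCast, hx', one_zpow]
      obtain ⟨u, v, huv⟩ : IsCoprime (p : ℤ) k :=
        (Nat.prime_iff_prime_int.1 hp).coprime_iff_not_dvd.2 hpk
      refine ⟨f ^ v, F.zpow_mem hf v, ?_⟩
      have : x ^ (u * p + v * k) = x := by rw [huv, zpow_one]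
      rw [zpow_add, mul_comm u, mul_comm v, zpow_mul, zpow_mul, hk, zpow_natCast, hx', one_zpow,
        one_mul] at this
      simpa using this
  have hfin := CommGroup.finite_quotient_range_pow htors e
    (CommGroup.finite_setOf_pow_eq_one_of_prime hprime he)
  have h1 : (powMonoidHom e : (A ⧸ A₀) →* _).range.FiniteIndex :=
    Subgroup.finiteIndex_of_finite_quotient
  have h2 : ((powMonoidHom e : (A ⧸ A₀) →* _).range.comap (QuotientGroup.mk' A₀)).FiniteIndex :=
    ⟨by rw [Subgroup.index_comap_of_surjective _ (QuotientGroup.mk'_surjective A₀)]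
        exact h1.index_ne_zero⟩
  refine @Subgroup.finiteIndex_of_le _ _ _ _ h2 ?_
  rintro x ⟨y, hy⟩
  induction y using QuotientGroup.induction_on with | H y =>
  have h2 : x * (y ^ e)⁻¹ ∈ A₀ := by
    rw [← QuotientGroup.eq_one_iff, QuotientGroup.mk_mul, QuotientGroup.mk_inv, mul_inv_eq_one]
    exact hy.symm
  have h3 := Subgroup.mul_mem_sup h2 (show y ^ e ∈ (powMonoidHom e : A →* A).range from ⟨y, rfl⟩)
  simpa using h3

/-! ### Alternating pairings on groups -/

/-- An alternating pairing has a subgroup `M` equal to its own orthogonal, namely any maximal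
isotropic subset. -/
theorem exists_subgroup_mem_iff_forall_pairing_eq_zero {H E : Type*} [Group H] [AddGroup E]
    (ψ : H → H → E)
    (hright : ∀ x y z, ψ x (y * z) = ψ x y + ψ x z) (hself : ∀ x, ψ x x = 0)
    (hskew : ∀ x y, ψ x y = 0 → ψ y x = 0) :
    ∃ M : Subgroup H, ∀ x, x ∈ M ↔ ∀ m ∈ M, ψ m x = 0 := by
  obtain ⟨s, hs⟩ := zorn_subset {s : Set H | ∀ x ∈ s, ∀ y ∈ s, ψ x y = 0} (by
    intro c hc hchain
    refine ⟨⋃₀ c, ?_, fun _ => Set.subset_sUnion_of_mem⟩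
    rintro x ⟨t, ht, hx⟩ y ⟨t', ht', hy⟩
    obtain h | h := hchain.total ht ht'
    · exact hc ht' x (h hx) y hy
    · exact hc ht x hx y (h hy))
  have hmem : ∀ x, x ∈ s ↔ ∀ m ∈ s, ψ m x = 0 := by
    refine fun x => ⟨fun hx m hm => hs.prop m hm x hx, fun hx => ?_⟩
    refine hs.le_of_ge (y := insert x s) ?_ (Set.subset_insert x s) (Set.mem_insert x s)
    rintro a (rfl | ha) b (rfl | hb)
    · exact hself _
    · exact hskew _ _ (hx b hb)
    · exact hx a ha
    · exact hs.prop a ha b hb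
  have hone : ∀ m, ψ m 1 = 0 := fun m => by simpa using hright m 1 1
  refine ⟨⟨⟨⟨s, fun {a b} ha hb => ?_⟩, ?_⟩, fun {a} ha => ?_⟩, hmem⟩
  · rw [hmem] at *
    intro m hm
    rw [hright, ha m hm, hb m hm, add_zero]
  · exact (hmem 1).2 fun m _ => hone m
  · refine (hmem _).2 fun m hm => ?_
    have := hright m a a⁻¹
    rw [mul_inv_cancel, hone, (hmem a).1 ha m hm, zero_add] at this
    exact this.symm

/-- Group version of the existence of isotropic complements, for alternating pairings with values
in `ZMod p`. -/
theorem exists_isotropic_subgroup_sup_eq_top {H : Type*} [Group H] {p : ℕ} [Fact p.Prime]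
    (ψ : H → H → ZMod p) (hleft : ∀ x y z, ψ (x * y) z = ψ x z + ψ y z)
    (hright : ∀ x y z, ψ x (y * z) = ψ x y + ψ x z) (hself : ∀ x, ψ x x = 0)
    (M : Subgroup H) (hM : ∀ x, x ∈ M ↔ ∀ m ∈ M, ψ m x = 0) [Countable (H ⧸ M)] :
    ∃ N : Subgroup H, (∀ x ∈ N, ∀ y ∈ N, ψ x y = 0) ∧ M ⊔ N = ⊤ := by
  have hskew : ∀ x y, ψ x y = -ψ y x := fun x y => by
    have := hself (x * y)
    rw [hleft, hright, hright, hself, hself, zero_add, add_zero] at this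
    exact eq_neg_of_add_eq_zero_left this
  -- The quotient of `H` by the radical of `ψ`, realised as the space of functions `ψ x`.
  let Ψ : H →* Multiplicative (H → ZMod p) :=
    MonoidHom.mk' (fun x => Multiplicative.ofAdd (ψ x)) fun x y => by
      ext z; exact hleft x y z
  let V : Submodule (ZMod p) (H → ZMod p) :=
    AddSubgroup.toZModSubmodule p (Subgroup.toAddSubgroup' Ψ.range)
  have hV : ∀ v : V, ∃ x, ψ x = v := fun v => v.2
  let π : H →* Multiplicative V :=
    MonoidHom.mk' (fun x => Multiplicative.ofAdd ⟨ψ x, x, rfl⟩) fun x y => by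
      apply Subtype.ext; ext z; exact hleft x y z
  choose r hr using hV
  have hskew' : ∀ v w : V, v.1 (r w) = -w.1 (r v) := fun v w => by
    rw [← congrFun (hr v) (r w), hskew, congrFun (hr w) (r v)]
  let B : LinearMap.BilinForm (ZMod p) V := LinearMap.mk₂ (ZMod p) (fun v w => v.1 (r w))
    (fun _ _ _ => rfl) (fun _ _ _ => rfl)
    (fun v w w' => by rw [hskew', hskew' v w, hskew' v w', ← neg_add]; rfl)
    (fun c v w => by rw [hskew', hskew' v w, smul_neg]; rfl)
  have hB : ∀ x y, B (π x).toAdd (π y).toAdd = ψ x y := fun x y => by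
    change ψ x (r (π y).toAdd) = ψ x y
    rw [hskew, congrFun (hr (π y).toAdd) x, hskew x y]
    rfl
  have hπ : ∀ v : V, ∃ x, (π x).toAdd = v := fun v => ⟨r v, Subtype.ext (hr v)⟩
  have hBalt : B.IsAlt := fun v => by
    obtain ⟨x, rfl⟩ := hπ v
    rw [hB, hself]
  let W : Submodule (ZMod p) V := ⨅ m ∈ M, LinearMap.ker (B (π m).toAdd)
  have hW : ∀ x, (π x).toAdd ∈ W ↔ x ∈ M := fun x => by
    simp only [W, Submodule.mem_iInf, LinearMap.mem_ker, hB, hM x]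
  have hcount : Countable (V ⧸ W) := by
    refine Function.Surjective.countable (f := fun q : H ⧸ M => W.mkQ (π q.out).toAdd) fun v => ?_
    obtain ⟨v, rfl⟩ := W.mkQ_surjective v
    obtain ⟨x, rfl⟩ := hπ v
    obtain ⟨m, hm⟩ := QuotientGroup.mk_out_eq_mul M x
    refine ⟨x, ?_⟩
    simp only [hm, map_mul, toAdd_mul, map_add]
    simpa using (hW m).2 m.2
  obtain ⟨N, hN, hsup⟩ := B.exists_isotropic_sup_eq_top hBalt W fun v hv => by
    obtain ⟨x, rfl⟩ := hπ v
    exact (hW x).2 ((hM x).2 fun m hm => by rw [← hB]; exact hv _ ((hW m).2 hm))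
  refine ⟨N.toAddSubgroup.toSubgroup.comap π, fun x hx y hy => ?_, ?_⟩
  · rw [← hB]
    exact hN _ hx _ hy
  · rw [eq_top_iff]
    rintro x -
    obtain ⟨w, hw, n, hn, hwn⟩ := Submodule.mem_sup.1 (hsup ▸ Submodule.mem_top :
      (π x).toAdd ∈ W ⊔ N)
    obtain ⟨m, rfl⟩ := hπ w
    have h1 : m⁻¹ * x ∈ N.toAddSubgroup.toSubgroup.comap π := by
      have h2 : (π (m⁻¹ * x)).toAdd = n := by
        rw [map_mul, map_inv, toAdd_mul, toAdd_inv, ← hwn]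
        abel
      change (π (m⁻¹ * x)).toAdd ∈ N
      rwa [h2]
    simpa using Subgroup.mul_mem_sup ((hW m).1 hw) h1

/-- The quotient by a maximal proper subgroup is simple, hence cyclic of prime order. -/
theorem CommGroup.exists_hom_multiplicative_zmod_ne_one {D : Type*} [CommGroup D] [Finite D]
    [Nontrivial D] :
    ∃ p : ℕ, p.Prime ∧ ∃ χ : D →* Multiplicative (ZMod p), χ ≠ 1 := by
  obtain ⟨K, hK⟩ := IsCoatomic.exists_coatom (Subgroup D)
  have hnt : Nontrivial (D ⧸ K) := QuotientGroup.nontrivial_iff.2 hK.1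
  have hsimple : IsSimpleGroup (D ⧸ K) := ⟨fun L _ => by
    have hinj := Subgroup.comap_injective (QuotientGroup.mk'_surjective K)
    rcases hK.le_iff.1 (QuotientGroup.le_comap_mk' K L) with h | h
    · exact .inr (hinj (by rw [h, Subgroup.comap_top]))
    · exact .inl (hinj (by rw [h, MonoidHom.comap_bot, QuotientGroup.ker_mk']))⟩
  have hp := IsSimpleGroup.prime_card (α := D ⧸ K)
  have hcyc : IsCyclic (D ⧸ K) := IsSimpleGroup.isCyclic
  refine ⟨_, hp, (zmodCyclicMulEquiv hcyc).symm.toMonoidHom.comp (QuotientGroup.mk' K), ?_⟩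
  intro h
  obtain ⟨x, hx⟩ := exists_ne (1 : D ⧸ K)
  obtain ⟨d, rfl⟩ := QuotientGroup.mk'_surjective K x
  have := DFunLike.congr_fun h d
  exact hx (by simpa using this)

/-! ### Subgroups of countable index and centralizers -/

section CountableIndex

variable {G : Type*} [Group G]

theorem Subgroup.countable_quotient_of_le {X Y : Subgroup G} (h : X ≤ Y) [Countable (G ⧸ X)] :
    Countable (G ⧸ Y) :=
  Function.Surjective.countable (f := Subgroup.quotientMapOfLE h) fun q => by
    induction q using QuotientGroup.induction_on with | H g => exact ⟨g, rfl⟩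

theorem Subgroup.countable_quotient_inf (X Y : Subgroup G) [Countable (G ⧸ X)]
    [Countable (G ⧸ Y)] : Countable (G ⧸ X ⊓ Y) := by
  refine Function.Injective.countable (f := fun q : G ⧸ X ⊓ Y =>
    (Subgroup.quotientMapOfLE inf_le_left q, Subgroup.quotientMapOfLE inf_le_right q)) ?_
  intro a b hab
  induction a using QuotientGroup.induction_on with | H a =>
  induction b using QuotientGroup.induction_on with | H b =>
  obtain ⟨h1, h2⟩ := Prod.ext_iff.1 hab
  exact QuotientGroup.eq.2 ⟨QuotientGroup.eq.1 h1, QuotientGroup.eq.1 h2⟩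

theorem Subgroup.countable_quotient_subgroupOf (X H : Subgroup G) [Countable (G ⧸ X)] :
    Countable (H ⧸ X.subgroupOf H) := by
  refine Function.Injective.countable (f := fun q : H ⧸ X.subgroupOf H =>
    ((q.out : G) : G ⧸ X)) fun a b hab => ?_
  rw [← QuotientGroup.out_eq' a, ← QuotientGroup.out_eq' b, QuotientGroup.eq]
  exact Subgroup.mem_subgroupOf.2 (QuotientGroup.eq.1 hab)

theorem Subgroup.centralizer_inf_centralizer_le_centralizer_sup (X Y : Subgroup G) :
    centralizer (X : Set G) ⊓ centralizer Y ≤ centralizer (X ⊔ Y : Subgroup G) := by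
  rw [Subgroup.le_centralizer_iff]
  refine sup_le ?_ ?_
  · rw [Subgroup.le_centralizer_iff]; exact inf_le_left
  · rw [Subgroup.le_centralizer_iff]; exact inf_le_right

/-- If `G'` is finite, then conjugacy classes are finite, as `g ^ x` lies in the coset `G' g`. -/
theorem Subgroup.finiteIndex_centralizer_singleton [Finite (_root_.commutator G)] (g : G) :
    (centralizer {g}).FiniteIndex := by
  have h1 : commutatorSet G ⊆ _root_.commutator G := by
    rw [commutator_eq_closure]; exact Subgroup.subset_closure
  have : Finite (commutatorSet G) :=
    Set.Finite.subset (Set.toFinite (_root_.commutator G : Set G)) h1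
  have : Finite (G ⧸ centralizer {g}) :=
    Finite.of_injective _ (quotientCentralizerEmbedding g).injective
  exact Subgroup.finiteIndex_of_finite_quotient

theorem Subgroup.finiteIndex_centralizer_of_finite [Finite (_root_.commutator G)] (s : Set G)
    [Finite s] : (centralizer s).FiniteIndex := by
  have h1 : ∀ g : s, (centralizer {(g : G)}).FiniteIndex :=
    fun g => finiteIndex_centralizer_singleton _
  have := Subgroup.finiteIndex_iInf h1
  refine Subgroup.finiteIndex_of_le (H := ⨅ g : s, centralizer {(g : G)}) fun x hx => ?_
  rw [Subgroup.mem_iInf] at hx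
  exact Subgroup.mem_centralizer_iff.2 fun g hg =>
    Subgroup.mem_centralizer_iff.1 (hx ⟨g, hg⟩) g rfl

theorem Subgroup.countable_quotient_centralizer_of_relIndex_ne_zero [Finite (_root_.commutator G)]
    {A B : Subgroup G} (h : B.relIndex A ≠ 0)
    [Countable (G ⧸ centralizer (B : Set G))] : Countable (G ⧸ centralizer (A : Set G)) := by
  have hfin : Finite (A ⧸ B.subgroupOf A) := Nat.finite_of_card_ne_zero h
  let s : Set G := Set.range fun q : A ⧸ B.subgroupOf A => (q.out : G)
  have hs : (centralizer s).FiniteIndex := finiteIndex_centralizer_of_finite s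
  have := countable_quotient_inf (centralizer (B : Set G)) (centralizer s)
  refine countable_quotient_of_le (X := centralizer (B : Set G) ⊓ centralizer s) ?_
  rintro x ⟨hxB, hxs⟩
  refine Subgroup.mem_centralizer_iff.2 fun a ha => ?_
  obtain ⟨b, hb⟩ := QuotientGroup.mk_out_eq_mul (B.subgroupOf A) ⟨a, ha⟩
  have h1 := Subgroup.mem_centralizer_iff.1 hxB _ (B.inv_mem b.2)
  have h2 := Subgroup.mem_centralizer_iff.1 hxs _ ⟨QuotientGroup.mk ⟨a, ha⟩, rfl⟩
  beta_reduce at h2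
  rw [hb] at h2
  have h3 : a = (a * b) * (b : G)⁻¹ := by group
  have h4 : Commute (a * (b : G)) x := h2
  have h5 : Commute ((b : G)⁻¹) x := h1
  rw [h3]
  exact h4.mul_left h5

end CountableIndex

/-! ### Abelian subgroups centralizing the commutator subgroup -/

section Abelian

open scoped commutatorElement

variable {G : Type*} [Group G]

theorem commute_of_le_centralizer_commutator {H : Subgroup G}
    (hH : H ≤ Subgroup.centralizer (commutator G : Set G)) {h : G} (hh : h ∈ H) (x y : G) :
    Commute ⁅x, y⁆ h :=
  Subgroup.mem_centralizer_iff.1 (hH hh) _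
    (Subgroup.commutator_mem_commutator (Subgroup.mem_top x) (Subgroup.mem_top y))

/-- If `a` commutes with `G'`, then `⁅g, a ^ n⁆ = ⁅g, a⁆ ^ n`, which is trivial for `n = |G'|`. -/
theorem pow_natCard_commutator_mem_center [Finite (commutator G)] {a : G}
    (ha : a ∈ Subgroup.centralizer (commutator G : Set G)) :
    a ^ Nat.card (commutator G) ∈ Subgroup.center G := by
  refine Subgroup.mem_center_iff.2 fun g => ?_
  have hmem : ⁅g, a⁆ ∈ commutator G :=
    Subgroup.commutator_mem_commutator (Subgroup.mem_top g) (Subgroup.mem_top a)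
  have h1 : Commute ⁅g, a⁆ a := Subgroup.mem_centralizer_iff.1 ha _ hmem
  have h2 : ⁅g, a⁆ ^ Nat.card (commutator G) = 1 := by
    exact congrArg Subtype.val (pow_card_eq_one' (x := (⟨⁅g, a⁆, hmem⟩ : commutator G)))
  have h3 : g * a * g⁻¹ = ⁅g, a⁆ * a := by rw [commutatorElement_def]; group
  have h4 : g * a ^ Nat.card (commutator G) * g⁻¹ = a ^ Nat.card (commutator G) := by
    rw [← conj_pow, h3, h1.mul_pow, h2, one_mul]
  exact mul_inv_eq_iff_eq_mul.1 h4

/-- If `g` normalizes `A`, then `⁅g, a⁆ ∈ A ⊓ G'` for all `a ∈ A`. -/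
theorem normalizer_le_centralizer_of_disjoint {A : Subgroup G}
    (h : Disjoint A (commutator G)) :
    Subgroup.normalizer (A : Set G) ≤ Subgroup.centralizer (A : Set G) := by
  refine fun g hg => Subgroup.mem_centralizer_iff.2 fun a ha => ?_
  have h1 : ⁅g, a⁆ ∈ A := A.mul_mem ((Subgroup.mem_normalizer_iff.1 hg a).1 ha) (A.inv_mem ha)
  have h2 : ⁅g, a⁆ ∈ commutator G :=
    Subgroup.commutator_mem_commutator (Subgroup.mem_top g) (Subgroup.mem_top a)
  exact (commutatorElement_eq_one_iff_mul_comm.1 (Subgroup.disjoint_def.1 h h1 h2)).symm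

/-- Passage from normalizers to centralizers for abelian `A` commuting with `G'`: a subgroup `B`
of `A` that avoids `G'` has `N(B) = C(B)`, and `B` can be chosen of finite index in `A` modulo
central elements. -/
theorem countable_quotient_centralizer_of_isMulCommutative [Finite (commutator G)] {A : Subgroup G}
    (hA : IsMulCommutative A) (hAC : A ≤ Subgroup.centralizer (commutator G : Set G))
    (h : ∀ B ≤ A, Countable (G ⧸ Subgroup.normalizer (B : Set G))) :
    Countable (G ⧸ Subgroup.centralizer (A : Set G)) := by
  let _ : CommGroup A :=
    { (inferInstance : Group A) with mul_comm := fun a b => hA.is_comm.comm a b }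
  have hF : Finite ((commutator G).subgroupOf A) :=
    Finite.of_injective (fun x => (⟨x.1.1, x.2⟩ : commutator G)) fun x y hxy =>
      Subtype.ext (Subtype.ext (Subtype.mk.inj hxy))
  obtain ⟨A₀, hdis, hfin⟩ := CommGroup.exists_disjoint_sup_range_pow_finiteIndex
    ((commutator G).subgroupOf A) (e := Nat.card (commutator G)) Nat.card_pos.ne'
  let B : Subgroup G := A₀.map A.subtype
  have hBA : B ≤ A := Subgroup.map_subtype_le A₀
  have hBdis : Disjoint B (commutator G) := by
    rw [Subgroup.disjoint_def]
    rintro _ ⟨a, ha, rfl⟩ hc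
    have : a = 1 := Subgroup.disjoint_def.1 hdis ha hc
    simp [this]
  have := h B hBA
  have hB : Countable (G ⧸ Subgroup.centralizer (B : Set G)) :=
    Subgroup.countable_quotient_of_le (normalizer_le_centralizer_of_disjoint hBdis)
  -- Adjoining central elements to `B` does not change its centralizer.
  let B' : Subgroup G := B ⊔ (Subgroup.center G ⊓ A)
  have hcent : Subgroup.centralizer (B : Set G) ≤ Subgroup.centralizer (B' : Set G) := by
    rw [Subgroup.le_centralizer_iff]
    refine sup_le ?_ (inf_le_left.trans (Subgroup.center_le_centralizer _))
    rw [Subgroup.le_centralizer_iff]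
  have hB' : Countable (G ⧸ Subgroup.centralizer (B' : Set G)) :=
    Subgroup.countable_quotient_of_le hcent
  refine Subgroup.countable_quotient_centralizer_of_relIndex_ne_zero (B := B') ?_
  have hle : A₀ ⊔ (powMonoidHom (Nat.card (commutator G)) : A →* A).range ≤ B'.subgroupOf A := by
    refine sup_le (fun a ha => ?_) ?_
    · exact (le_sup_left : B ≤ B') ⟨a, ha, rfl⟩
    · rintro _ ⟨a, rfl⟩
      exact (le_sup_right : _ ≤ B')
        ⟨pow_natCard_commutator_mem_center (hAC a.2), A.pow_mem a.2 _⟩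
  exact (Subgroup.finiteIndex_of_le hle).index_ne_zero

end Abelian

/-! ### From abelian subgroups to arbitrary subgroups -/

section Main

open scoped commutatorElement

variable {G : Type*} [Group G]

/-- Passage from abelian subgroups to all subgroups `H` commuting with `G'`, by induction on the
order of `⁅H, H⁆`. A nontrivial character `χ` of `⁅H, H⁆` turns the commutator into an alternating
pairing on `H`. With `M` equal to its own orthogonal and `N` an isotropic complement,
`C(H) = C(M) ⊓ C(N)`, and both `⁅M, M⁆` and `⁅N, N⁆` lie in `ker χ`. The complement exists because
`M` has countable index in `H`: it contains `H ⊓ C(M)`. -/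
theorem countable_quotient_centralizer_of_forall_isMulCommutative [Finite (commutator G)]
    (H : Subgroup G) (hH : H ≤ Subgroup.centralizer (commutator G : Set G))
    (hab : ∀ A ≤ H, IsMulCommutative A → Countable (G ⧸ Subgroup.centralizer (A : Set G))) :
    Countable (G ⧸ Subgroup.centralizer (H : Set G)) := by
  induction hn : Nat.card (⁅H, H⁆ : Subgroup G) using Nat.strong_induction_on generalizing H with
  | _ n ih =>
  by_cases hbot : ⁅H, H⁆ = ⊥
  · exact hab H le_rfl (Subgroup.commutator_self_eq_bot_iff.1 hbot)
  have hDG : ⁅H, H⁆ ≤ commutator G := Subgroup.commutator_mono le_top le_top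
  have hDfin : Finite (⁅H, H⁆ : Subgroup G) :=
    Finite.of_injective _ (Subgroup.inclusion_injective hDG)
  have hDnt : Nontrivial (⁅H, H⁆ : Subgroup G) := (Subgroup.nontrivial_iff_ne_bot _).2 hbot
  let _ : CommGroup (⁅H, H⁆ : Subgroup G) :=
    { (inferInstance : Group (⁅H, H⁆ : Subgroup G)) with
      mul_comm := fun a b => Subtype.ext (Subgroup.mem_centralizer_iff.1
        (hH (Subgroup.commutator_le_self H b.2)) a (hDG a.2)) }
  obtain ⟨p, hp, χ, hχ⟩ :=
    CommGroup.exists_hom_multiplicative_zmod_ne_one (D := (⁅H, H⁆ : Subgroup G))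
  have : Fact p.Prime := ⟨hp⟩
  let c : H → H → (⁅H, H⁆ : Subgroup G) := fun x y =>
    ⟨⁅(x : G), (y : G)⁆, Subgroup.commutator_mem_commutator x.2 y.2⟩
  let ψ : H → H → ZMod p := fun x y => (χ (c x y)).toAdd
  have hleft : ∀ x y z, ψ (x * y) z = ψ x z + ψ y z := fun x y z => by
    have h1 : c (x * y) z = c x z * c y z := by
      rw [mul_comm]
      refine Subtype.ext ?_
      change ⁅(x : G) * y, (z : G)⁆ = ⁅(y : G), (z : G)⁆ * ⁅(x : G), (z : G)⁆
      have h2 := commute_of_le_centralizer_commutator hH x.2 y z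
      rw [← h2.symm.mul_inv_cancel]
      simp only [commutatorElement_def]
      group
    simp only [ψ, h1, map_mul, toAdd_mul]
  have hskew : ∀ x y, ψ x y = -ψ y x := fun x y => by
    have h1 : c x y = (c y x)⁻¹ := Subtype.ext (commutatorElement_inv _ _).symm
    simp only [ψ, h1, map_inv, toAdd_inv]
  have hright : ∀ x y z, ψ x (y * z) = ψ x y + ψ x z := fun x y z => by
    rw [hskew, hleft, neg_add, ← hskew, ← hskew]
  have hself : ∀ x, ψ x x = 0 := fun x => by
    have h1 : c x x = 1 := Subtype.ext (commutatorElement_self _)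
    simp only [ψ, h1, map_one, toAdd_one]
  -- Subgroups on which `ψ` vanishes have a smaller commutator subgroup.
  have hiso : ∀ L : Subgroup H, (∀ x ∈ L, ∀ y ∈ L, ψ x y = 0) →
      Countable (G ⧸ Subgroup.centralizer (L.map H.subtype : Set G)) := by
    intro L hL
    have hLH : L.map H.subtype ≤ H := Subgroup.map_subtype_le L
    refine ih _ ?_ _ (hLH.trans hH) (fun A hA => hab A (hA.trans hLH)) rfl
    have h1 : ⁅L.map H.subtype, L.map H.subtype⁆ ≤ χ.ker.map (Subgroup.subtype ⁅H, H⁆) := by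
      rw [Subgroup.commutator_le]
      rintro _ ⟨x, hx, rfl⟩ _ ⟨y, hy, rfl⟩
      exact ⟨c x y, hL x hx y hy, rfl⟩
    have h2 : Nat.card (χ.ker.map (Subgroup.subtype ⁅H, H⁆)) = Nat.card χ.ker :=
      Subgroup.card_subtype _ _
    have h3 : Nat.card χ.ker < n := by
      rw [← hn]
      refine lt_of_le_of_ne (Subgroup.card_le_card_group _) fun h => hχ ?_
      exact MonoidHom.ker_eq_top_iff.1 (Subgroup.card_eq_iff_eq_top _ |>.1 h)
    have h4 : Finite (χ.ker.map (Subgroup.subtype ⁅H, H⁆)) :=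
      Finite.of_injective _ (Subgroup.inclusion_injective (Subgroup.map_subtype_le _))
    exact (Nat.card_le_card_of_injective _ (Subgroup.inclusion_injective h1)).trans_lt (h2 ▸ h3)
  obtain ⟨M, hM⟩ := exists_subgroup_mem_iff_forall_pairing_eq_zero ψ hright hself
    fun x y h => by rw [hskew, h, neg_zero]
  have hMc := hiso M fun x hx y hy => (hM y).1 hy x hx
  have hMq : Countable (H ⧸ M) := by
    have := Subgroup.countable_quotient_subgroupOf
      (Subgroup.centralizer (M.map H.subtype : Set G)) H
    refine Subgroup.countable_quotient_of_le
      (X := (Subgroup.centralizer (M.map H.subtype : Set G)).subgroupOf H) fun x hx => ?_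
    refine (hM x).2 fun m hm => ?_
    have h1 : c m x = 1 := Subtype.ext (commutatorElement_eq_one_iff_mul_comm.2
      (Subgroup.mem_centralizer_iff.1 (Subgroup.mem_subgroupOf.1 hx) m ⟨m, hm, rfl⟩))
    simp only [ψ, h1, map_one, toAdd_one]
  obtain ⟨N, hN, hsup⟩ := exists_isotropic_subgroup_sup_eq_top ψ hleft hright hself M hM
  have hNc := hiso N hN
  have := Subgroup.countable_quotient_inf (Subgroup.centralizer (M.map H.subtype : Set G))
    (Subgroup.centralizer (N.map H.subtype : Set G))
  have h1 := Subgroup.centralizer_inf_centralizer_le_centralizer_sup (M.map H.subtype)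
    (N.map H.subtype)
  rw [← Subgroup.map_sup, hsup, ← MonoidHom.range_eq_map, Subgroup.range_subtype] at h1
  exact Subgroup.countable_quotient_of_le h1

/-- Both parts of the theorem are instances of this statement: `H = ⊤` gives the centre, and a
countable `H` only involves normalizers of countable subgroups. -/
theorem countable_quotient_centralizer_of_forall_normalizer [Finite (commutator G)]
    (H : Subgroup G)
    (h : ∀ A ≤ H, IsMulCommutative A → Countable (G ⧸ Subgroup.normalizer (A : Set G))) :
    Countable (G ⧸ Subgroup.centralizer (H : Set G)) := by
  let C : Subgroup G := Subgroup.centralizer (commutator G : Set G)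
  have hC : C.FiniteIndex := Subgroup.finiteIndex_centralizer_of_finite _
  -- `H ⊓ C` has finite index in `H`, so it suffices to treat subgroups commuting with `G'`.
  have h1 : Countable (G ⧸ Subgroup.centralizer ((H ⊓ C : Subgroup G) : Set G)) := by
    refine countable_quotient_centralizer_of_forall_isMulCommutative _ inf_le_right fun A hA hcomm =>
      countable_quotient_centralizer_of_isMulCommutative hcomm (hA.trans inf_le_right)
        fun B hB => h B (hB.trans (hA.trans inf_le_left)) ?_
    rw [← Subgroup.commutator_self_eq_bot_iff] at hcomm ⊢
    exact eq_bot_iff.2 (hcomm ▸ Subgroup.commutator_mono hB hB)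
  refine Subgroup.countable_quotient_centralizer_of_relIndex_ne_zero
    (B := H ⊓ C) ?_
  rw [Subgroup.inf_relIndex_left]
  exact (Subgroup.instFiniteIndex_subgroupOf C H).index_ne_zero

end Main

/-! ### Cardinal formulation -/

theorem Cardinal.mk_lt_aleph_one_iff_countable {α : Type u} : #α < ℵ_ 1 ↔ Countable α := by
  rw [Cardinal.lt_aleph_one_iff, Cardinal.mk_le_aleph0_iff]

theorem IsTomkinsonZ.isTomkinsonY {G : Type u} [Group G] (h : IsTomkinsonZ G) : IsTomkinsonY G :=
  ⟨h.1, fun κ hκ H hH => lt_of_le_of_lt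
    (Cardinal.mk_le_of_surjective (f := Subgroup.quotientMapOfLE
        (Subgroup.centralizer_le_normalizer (H : Set G))) fun q => by
      induction q using QuotientGroup.induction_on with | H g => exact ⟨g, rfl⟩)
    (h.2 κ hκ H hH)⟩

/-- Finite subgroups are handled by finiteness of conjugacy classes, and for `κ > ℵ₁` the index is
at most `|G| < κ`. The case with content is `κ = ℵ₁`. -/
theorem IsTomkinsonY.isTomkinsonZ {G : Type u} [Group G] (hG : IsFiniteByAbelian G)
    (hcard : #G = ℵ_ 1) (h : IsTomkinsonY G) : IsTomkinsonZ G := by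
  have : Finite (commutator G) := hG
  refine ⟨h.1, fun κ hκ H hH => ?_⟩
  obtain rfl | hκ0 := hκ.eq_or_lt
  · have : Finite H := Cardinal.lt_aleph0_iff_finite.1 hH
    have := Subgroup.finiteIndex_centralizer_of_finite (H : Set G)
    exact Cardinal.lt_aleph0_of_finite _
  obtain rfl | hκ1 := (Cardinal.aleph_one_le_iff.2 hκ0).eq_or_lt
  · have : Countable H := Cardinal.mk_lt_aleph_one_iff_countable.1 hH
    refine Cardinal.mk_lt_aleph_one_iff_countable.2
      (countable_quotient_centralizer_of_forall_normalizer H fun A hA _ =>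
        Cardinal.mk_lt_aleph_one_iff_countable.1 (h.2 _ hκ A ?_))
    exact (Cardinal.mk_le_mk_of_subset hA).trans_lt hH
  · exact (Cardinal.mk_quotient_le.trans_eq hcard).trans_lt hκ1

theorem theoremC :
    (∀ (G : Type u) [Group G], IsFiniteByAbelian G →
      List.TFAE [
        #(G ⧸ Subgroup.center G) < ℵ_ 1,
        ∀ U : Subgroup G, cardIndex (Subgroup.normalizer (U : Set G)) < ℵ_ 1,
        ∀ A : Subgroup G, IsMulCommutative A →
          cardIndex (Subgroup.normalizer (A : Set G)) < ℵ_ 1]) ∧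
    (∀ (G : Type u) [Group G], IsFiniteByAbelian G → #G = ℵ_ 1 →
      (IsTomkinsonY G ↔ IsTomkinsonZ G)) := by
  refine ⟨fun G _ hG => ?_, fun G _ hG hcard =>
    ⟨fun h => h.isTomkinsonZ hG hcard, fun h => h.isTomkinsonY⟩⟩
  have : Finite (commutator G) := hG
  simp only [cardIndex, Cardinal.mk_lt_aleph_one_iff_countable]
  tfae_have 1 → 2 := fun _ U => Subgroup.countable_quotient_of_le
    ((Subgroup.center_le_centralizer _).trans (Subgroup.centralizer_le_normalizer _))
  tfae_have 2 → 3 := fun h A _ => h A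
  tfae_have 3 → 1 := fun h => by
    have := countable_quotient_centralizer_of_forall_normalizer (⊤ : Subgroup G) fun A _ => h A
    rwa [Subgroup.coe_top, Subgroup.centralizer_univ] at this
  tfae_finish
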